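/- For $g\in L^2(\mathbb R)$ and $z=x+iy\in\mathbb C$ let $g_z(t)=e^{-2\pi i y t}g(t-x)$, and for $f\in L^2(\mathbb R)$ let $Gf(z)=\langle f,g_z\rangle=\int_{\mathbb R}f(t)\overline{g_z(t)}\,dt$ be the Gabor transform with window $g$. The model space is $H_g=\{F\in L^2(\mathbb C): F=Gf \text{ pointwise for some } f\in L^2(\mathbb R)\}$. A discrete set $\Lambda\subset\mathbb C$ is a sampling set for $H_g$ if there are constants $A,B>0$ with $A\|F\|^2\le\sum_{\lambda\in\Lambda}|F(\lambda)|^2\le B\|F\|^2$ for all $F\in H_g$, where $\|F\|$ is the norm of $L^2(\mathbb C)$. **Theorem.** Let $g\in L^2(\mathbb R)$ with $\|g\|=1$ belong to the Feichtinger algebra, that is, $k(z)=\langle g,g_z\rangle$ lies in $L^1(\mathbb C)$. (1) Let $\Lambda=\{z_j\}_{j\in\mathbb N}$, with the $z_j$ pairwise distinct, be a sampling set for $H_g$. Then there is $\delta>0$ such that for every sequence $(w_j)_{j\in\mathbb N}$ in $\mathbb C$ with $|z_j-w_j|<\delta$ for all $j$, the set $\Gamma=\{w_j: j\in\mathbb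 N\}$ is discrete and is also a sampling set for $H_g$; moreover, there are constants $A',B'>0$ with $A'\|F\|^2\le\sum_{j\in\mathbb N}|F(w_j)|^2\le B'\|F\|^2$ for all $F\in H_g$, so that sampling inequalities hold also when coinciding points $w_j$ are counted with multiplicity. (2) Consequently the Gabor frame property is stable under small perturbations: if $(z_j)_{j\in\mathbb N}$ is a sequence in $\mathbb C$ (repetitions allowed) such that $(g_{z_j})_{j\in\mathbb N}$ is a frame of $L^2(\mathbb R)$, then there is $\delta>0$ such that $(g_{w_j})_{j\in\mathbb N}$ is a frame of $L^2(\mathbb R)$ for every sequence $(w_j)_{j\in\mathbb N}$ in $\mathbb C$ with $|z_j-w_j|<\delta$ for all $j$. Here $(e_j)$ is a frame if there are $A,B>0$ with $A\|f\|^2\le\sum_j|\langle f,e_j\rangle|^2\le B\|f\|^2$ for all $f\in L^2(\mathbb R)$. -/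

import Mathlib

open MeasureTheory Set
open scoped ENNReal ComplexConjugate

namespace GaborSampling

noncomputable section

/-- The Hilbert space `L²(ℝ)` of complex valued square integrable functions. -/
abbrev L2R : Type := Lp ℂ 2 (volume : Measure ℝ)

/-- The time-frequency shift `g_z(t) = e^{-2πi y t} g(t - x)`, `z = x + i y`, of a function. -/
def shiftFun (g : ℝ → ℂ) (z : ℂ) (t : ℝ) : ℂ :=
  Complex.exp (-2 * Real.pi * Complex.I * z.im * t) * g (t - z.re)

theorem norm_shiftFun (g : ℝ → ℂ) (z : ℂ) (t : ℝ) : ‖shiftFun g z t‖ = ‖g (t - z.re)‖ := by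
  have h : (-2 * Real.pi * Complex.I * z.im * t : ℂ)
      = ((-2 * Real.pi * z.im * t : ℝ) : ℂ) * Complex.I := by
    push_cast; ring
  rw [shiftFun, norm_mul, h, Complex.norm_exp_ofReal_mul_I, one_mul]

theorem memLp_shiftFun {g : ℝ → ℂ} (hg : MemLp g 2 volume) (z : ℂ) :
    MemLp (shiftFun g z) 2 volume := by
  have h1 : MemLp (fun t : ℝ => g (t - z.re)) 2 volume :=
    hg.comp_measurePreserving (measurePreserving_sub_right volume z.re)
  refine h1.of_le ?_ (Filter.Eventually.of_forall fun t => (norm_shiftFun g z t).le)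
  have h2 : Continuous (fun t : ℝ => Complex.exp (-2 * Real.pi * Complex.I * z.im * t)) := by
    fun_prop
  exact h2.aestronglyMeasurable.mul h1.aestronglyMeasurable

/-- The atom `g_z`, as an element of `L²(ℝ)`. -/
def atom (g : L2R) (z : ℂ) : L2R :=
  (memLp_shiftFun (Lp.memLp g) z).toLp (shiftFun g z)

/-- The Gabor transform `Gf(z) = ⟨f, g_z⟩` with window `g`
(Mathlib's inner product is conjugate linear in its first argument). -/
def gaborTransform (g f : L2R) (z : ℂ) : ℂ := inner ℂ (atom g z) f

/-- The Gabor transform as an integral. -/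
theorem gaborTransform_eq_integral (g f : L2R) (z : ℂ) :
    gaborTransform g f z = ∫ t : ℝ, f t *
      conj (Complex.exp (-2 * Real.pi * Complex.I * z.im * t) * g (t - z.re)) := by
  rw [gaborTransform, L2.inner_def]
  refine integral_congr_ae ?_
  filter_upwards [(memLp_shiftFun (Lp.memLp g) z).coeFn_toLp] with t ht
  rw [atom, ht]
  simp [shiftFun]

/-- The Feichtinger algebra: the `g ∈ L²(ℝ)` whose kernel `k(z) = ⟨g, g_z⟩` lies in `L¹(ℂ)`. -/
def feichtingerAlgebra : Set L2R :=
  {g | Integrable (fun z : ℂ => gaborTransform g g z) volume}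

/-- The model space `H_g` of all Gabor transforms, as a space of functions on `ℂ`
in `L²(ℂ)`. -/
def modelSpace (g : L2R) : Set (ℂ → ℂ) :=
  {F | MemLp F 2 volume ∧ ∃ f : L2R, ∀ z, F z = gaborTransform g f z}

/-- The sampling inequalities `A ‖F‖² ≤ ∑ |F(z_j)|² ≤ B ‖F‖²` on `H_g` for an indexed family of
points, each index being counted. The sum is taken in `[0, ∞]`. -/
def IsSamplingFamily {ι : Type*} (g : L2R) (z : ι → ℂ) : Prop :=
  ∃ A B : ℝ, 0 < A ∧ 0 < B ∧ ∀ F ∈ modelSpace g,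
    ENNReal.ofReal A * eLpNorm F 2 volume ^ 2 ≤ ∑' j, ‖F (z j)‖ₑ ^ 2 ∧
    ∑' j, ‖F (z j)‖ₑ ^ 2 ≤ ENNReal.ofReal B * eLpNorm F 2 volume ^ 2

/-- A sampling set for `H_g`: a discrete set that satisfies the sampling inequalities, each of
its points being counted once. -/
def IsSamplingSet (g : L2R) (Λ : Set ℂ) : Prop :=
  IsDiscrete Λ ∧ IsSamplingFamily g (fun l : Λ => (l : ℂ))

/-- Frames of a Hilbert space. The sum is taken in `[0, ∞]`. -/
def IsFrame {ι H : Type*} [NormedAddCommGroup H] [InnerProductSpace ℂ H] (e : ι → H) : Prop :=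
  ∃ A B : ℝ, 0 < A ∧ 0 < B ∧ ∀ f : H,
    ENNReal.ofReal A * ‖f‖ₑ ^ 2 ≤ ∑' j, ‖inner ℂ (e j) f‖ₑ ^ 2 ∧
    ∑' j, ‖inner ℂ (e j) f‖ₑ ^ 2 ≤ ENNReal.ofReal B * ‖f‖ₑ ^ 2

end

end GaborSampling

namespace GaborSampling

open FourierTransform

/-! By Moyal's identity the Gabor transform is an isometry onto `H_g`, so sampling families are
exactly frames of atoms, and it suffices to perturb frames.

Put `u = w_j - z_j` and `a = g_u - g`. Up to a unimodular factor on `g_{w_j}`, the vector `g_{w_j} -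
g_{z_j}` is `a` shifted by `z_j`. For an auxiliary window `h` with `⟨g, h⟩ ≠ 0`, Moyal's identity
bounds its coefficient against `f`, times `|⟨g, h⟩|`, by the integral over `ζ` of `|⟨h_ζ, a⟩|
|⟨g_{ζ+z_j}, f⟩|` (`enorm_inner_mul_le_lintegral`). If `|⟨h_ζ, a⟩| ≤ Φ(ζ)` for all small `u`, with
`∫ Φ` small, then Cauchy–Schwarz and the Bessel bound, which is unaffected by shifting all the
points, make the square sum of the differences small relative to `‖f‖²` (`tsum_sq_lintegral_le`).

Such a `Φ` exists when `h` is an average of the atoms `g_z` with weight `k(z)`: local averages of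
`|k|` then dominate uniformly in `u`, whereas `h = g` would require integrable local suprema of
`|k|`. Dominated convergence makes `∫ Φ` small (`exists_dominated_perturbation`).

Coinciding points are harmless because a Bessel sequence of atoms has bounded multiplicity on small
discs. -/

/-! ### Algebra of time-frequency shifts. -/

theorem coeFn_atom (g : L2R) (z : ℂ) : atom g z =ᵐ[volume] shiftFun g z :=
  (memLp_shiftFun (Lp.memLp g) z).coeFn_toLp

theorem shiftFun_congr_ae {f g : ℝ → ℂ} (h : f =ᵐ[volume] g) (z : ℂ) :
    shiftFun f z =ᵐ[volume] shiftFun g z := by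
  have h1 := (measurePreserving_sub_right volume z.re).quasiMeasurePreserving.ae_eq_comp h
  filter_upwards [h1] with t ht
  simp only [Function.comp_apply] at ht
  simp only [shiftFun, ht]

theorem eq_atom_of_ae {g : L2R} {f : L2R} {z : ℂ} (h : f =ᵐ[volume] shiftFun g z) :
    f = atom g z :=
  Lp.ext (h.trans (coeFn_atom g z).symm)

theorem atom_add (f g : L2R) (z : ℂ) : atom (f + g) z = atom f z + atom g z := by
  refine (eq_atom_of_ae ?_).symm
  filter_upwards [Lp.coeFn_add (atom f z) (atom g z), coeFn_atom f z, coeFn_atom g z,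
    shiftFun_congr_ae (Lp.coeFn_add f g) z] with t h1 h2 h3 h4
  rw [h1, h4]
  simp only [Pi.add_apply, h2, h3, shiftFun]
  ring

theorem atom_smul (c : ℂ) (g : L2R) (z : ℂ) : atom (c • g) z = c • atom g z := by
  refine (eq_atom_of_ae ?_).symm
  filter_upwards [Lp.coeFn_smul c (atom g z), coeFn_atom g z,
    shiftFun_congr_ae (Lp.coeFn_smul c g) z] with t h1 h2 h4
  rw [h1, h4]
  simp only [Pi.smul_apply, h2, shiftFun, smul_eq_mul]
  ring

theorem norm_atom (g : L2R) (z : ℂ) : ‖atom g z‖ = ‖g‖ := by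
  have h1 : eLpNorm (shiftFun g z) 2 volume = eLpNorm (fun t : ℝ => g (t - z.re)) 2 volume :=
    eLpNorm_congr_norm_ae (Filter.Eventually.of_forall fun t => norm_shiftFun g z t)
  have h2 : eLpNorm (fun t : ℝ => g (t - z.re)) 2 volume = eLpNorm g 2 volume :=
    eLpNorm_comp_measurePreserving (Lp.aestronglyMeasurable g)
      (measurePreserving_sub_right volume z.re)
  rw [atom, Lp.norm_toLp, h1, h2, Lp.norm_def]

/-- The time-frequency shift by `z` as a linear isometry of `L²(ℝ)`. -/
noncomputable def tfShift (z : ℂ) : L2R →ₗᵢ[ℂ] L2R where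
  toFun g := atom g z
  map_add' f g := atom_add f g z
  map_smul' c g := atom_smul c g z
  norm_map' g := norm_atom g z

theorem atom_sub (f g : L2R) (z : ℂ) : atom (f - g) z = atom f z - atom g z :=
  map_sub (tfShift z) f g

theorem inner_atom_atom (f g : L2R) (z : ℂ) : inner ℂ (atom f z) (atom g z) = inner ℂ f g :=
  (tfShift z).inner_map_map f g

/-- The phase factor in the composition of two time-frequency shifts. -/
noncomputable def phase (z w : ℂ) : ℂ := Complex.exp ((2 * Real.pi * z.im * w.re : ℝ) * Complex.I)

@[simp] theorem norm_phase (z w : ℂ) : ‖phase z w‖ = 1 := Complex.norm_exp_ofReal_mul_I _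

theorem atom_atom (g : L2R) (z w : ℂ) : atom (atom g z) w = phase z w • atom g (z + w) := by
  refine (eq_atom_of_ae ?_).symm
  filter_upwards [Lp.coeFn_smul (phase z w) (atom g (z + w)), coeFn_atom g (z + w),
    shiftFun_congr_ae (coeFn_atom g z) w] with t h1 h2 h3
  rw [h1, h3]
  simp only [Pi.smul_apply, h2, shiftFun, smul_eq_mul, phase, Complex.add_re, Complex.add_im]
  rw [← mul_assoc, ← mul_assoc, ← Complex.exp_add, ← Complex.exp_add]
  congr 2
  · push_cast; ring
  · ring

theorem atom_zero (g : L2R) : atom g 0 = g := by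
  refine (eq_atom_of_ae ?_).symm
  refine Filter.Eventually.of_forall fun t => ?_
  simp [shiftFun]

theorem norm_inner_atom_comm (f g : L2R) (z : ℂ) :
    ‖inner ℂ (atom f z) g‖ = ‖inner ℂ f (atom g (-z))‖ := by
  rw [← inner_atom_atom (atom f z) g (-z), atom_atom, add_neg_cancel, atom_zero, inner_smul_left,
    norm_mul, RCLike.norm_conj, norm_phase, one_mul]

theorem norm_inner_atom_atom_left (f g : L2R) (z w : ℂ) :
    ‖inner ℂ (atom (atom f z) w) g‖ = ‖inner ℂ (atom f (z + w)) g‖ := by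
  rw [atom_atom, inner_smul_left, norm_mul, RCLike.norm_conj, norm_phase, one_mul]

/-! ### Strong continuity of time-frequency shifts. -/

theorem continuous_atom_ofReal (g : L2R) : Continuous fun x : ℝ => atom g x := by
  have h : ∀ x : ℝ, atom g x = Lp.compMeasurePreserving (fun t : ℝ => t - x)
      (measurePreserving_sub_right volume x) g := by
    intro x
    refine (eq_atom_of_ae ?_).symm
    filter_upwards [Lp.coeFn_compMeasurePreserving g (measurePreserving_sub_right volume x)]
      with t ht
    rw [ht]
    simp [shiftFun]
  simp_rw [h]
  have hc : Continuous fun x : ℝ => (⟨fun t : ℝ => t - x, by fun_prop⟩ : C(ℝ, ℝ)) :=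
    ContinuousMap.continuous_of_continuous_uncurry _
      (by exact continuous_snd.sub continuous_fst)
  exact Continuous.compMeasurePreservingLp (continuous_const (y := g)) hc
    (fun x => measurePreserving_sub_right volume x) (by simp)

theorem continuous_atom_ofReal_mul_I (g : L2R) :
    Continuous fun y : ℝ => atom g (y * Complex.I) := by
  refine continuous_iff_continuousAt.2 fun y₀ => ?_
  rw [ContinuousAt]
  have hm : ∀ y : ℝ, MemLp (shiftFun g (y * Complex.I)) 2 volume := fun y =>
    memLp_shiftFun (Lp.memLp g) _
  refine (Lp.tendsto_Lp_iff_tendsto_eLpNorm'' _ hm _ (hm y₀)).2 ?_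
  have hsq : Filter.Tendsto (fun y : ℝ => ∫⁻ t, ‖shiftFun g (y * Complex.I) t -
      shiftFun g (y₀ * Complex.I) t‖ₑ ^ (2 : ℝ)) (nhds y₀) (nhds (∫⁻ _ : ℝ, 0)) := by
    refine tendsto_lintegral_filter_of_dominated_convergence
      (fun t => (2 * ‖g t‖ₑ) ^ (2 : ℝ)) ?_ ?_ ?_ ?_
    · refine Filter.Eventually.of_forall fun y => ?_
      have h3 : ∀ y : ℝ, Measurable (shiftFun g (y * Complex.I)) := fun y => by
        have := (Lp.stronglyMeasurable g).measurable
        unfold shiftFun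
        fun_prop
      exact ((h3 y).sub (h3 y₀)).enorm.pow_const _
    · refine Filter.Eventually.of_forall fun y => Filter.Eventually.of_forall fun t => ?_
      refine ENNReal.rpow_le_rpow ?_ (by norm_num)
      have h1 : ∀ y : ℝ, ‖shiftFun g (y * Complex.I) t‖ₑ = ‖g t‖ₑ := by
        intro y
        rw [← ofReal_norm, norm_shiftFun, ofReal_norm]
        simp
      calc _ ≤ ‖shiftFun g (y * Complex.I) t‖ₑ + ‖shiftFun g (y₀ * Complex.I) t‖ₑ := enorm_sub_le
        _ = _ := by rw [h1, h1, two_mul]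
    · have h4 : ∀ t, (2 * ‖g t‖ₑ) ^ (2 : ℝ) = ‖((2 : ℂ) • (g : ℝ → ℂ)) t‖ₑ ^ (2 : ℝ) := by
        intro t
        have h2 : ‖(2 : ℂ)‖ₑ = 2 := by
          rw [← ofReal_norm]; simp
        rw [Pi.smul_apply, enorm_smul, h2]
      simp_rw [h4]
      have h5 := lintegral_rpow_enorm_lt_top_of_eLpNorm_lt_top (by norm_num) (by norm_num)
        ((Lp.memLp g).const_smul (2 : ℂ)).2
      exact h5.ne
    · refine Filter.Eventually.of_forall fun t => ?_
      have : Continuous fun y : ℝ => ‖shiftFun g (y * Complex.I) t -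
          shiftFun g (y₀ * Complex.I) t‖ₑ ^ (2 : ℝ) := by
        refine ENNReal.continuous_rpow_const.comp (Continuous.enorm ?_)
        refine Continuous.sub ?_ continuous_const
        have h2 : (fun y : ℝ => shiftFun g (y * Complex.I) t) = fun y : ℝ =>
            Complex.exp (-2 * Real.pi * Complex.I * y * t) * g t := by
          ext y; simp [shiftFun]
        rw [h2]
        fun_prop
      simpa using this.tendsto y₀
  have hrt := (ENNReal.continuous_rpow_const (y := 1 / 2)).tendsto _ |>.comp hsq
  rw [lintegral_zero, ENNReal.zero_rpow_of_pos (by norm_num)] at hrt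
  refine hrt.congr fun y => ?_
  rw [eLpNorm_eq_lintegral_rpow_enorm_toReal (by norm_num) (by norm_num)]
  simp

/-- A shift is a translation followed by a modulation. Modulations are isometric, so the translation
error passes through unchanged, and the remaining error involves modulations of one fixed function.
-/
theorem continuous_atom (g : L2R) : Continuous fun z : ℂ => atom g z := by
  have hd : ∀ z : ℂ, atom g z = atom (atom g z.re) (z.im * Complex.I) := by
    intro z
    rw [atom_atom, Complex.re_add_im]
    simp [phase]
  refine continuous_iff_continuousAt.2 fun z₀ => ?_
  rw [ContinuousAt, tendsto_iff_norm_sub_tendsto_zero]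
  have h1 : Continuous fun z : ℂ => ‖atom g z.re - atom g z₀.re‖ +
      ‖atom (atom g z₀.re) (z.im * Complex.I) - atom (atom g z₀.re) (z₀.im * Complex.I)‖ :=
    ((((continuous_atom_ofReal g).comp Complex.continuous_re).sub continuous_const).norm).add
     ((((continuous_atom_ofReal_mul_I (atom g z₀.re)).comp Complex.continuous_im).sub
        continuous_const).norm)
  refine squeeze_zero (fun _ => norm_nonneg _) (fun z => ?_) (by simpa using h1.tendsto z₀)
  rw [hd z, hd z₀, ← norm_atom (atom g z.re - atom g z₀.re) (z.im * Complex.I), atom_sub]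
  exact norm_sub_le_norm_sub_add_norm_sub _ _ _

theorem continuous_gaborTransform (g f : L2R) : Continuous (gaborTransform g f) :=
  (continuous_atom g).inner continuous_const

/-! ### Plancherel's theorem and Moyal's identity. -/

/-- Tested against smooth compactly supported functions, both transforms move onto the test
function: one by the definition for tempered distributions, the other by the multiplication formula.
-/
theorem coeFn_fourier_toLp_ae {f : ℝ → ℂ} (h1 : Integrable f) (h2 : MemLp f 2 volume) :
    (𝓕 (h2.toLp f) : L2R) =ᵐ[volume] 𝓕 f := by
  have hcont : Continuous (𝓕 f) :=
    VectorFourier.fourierIntegral_continuous Real.continuous_fourierChar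
      (by exact continuous_inner) h1
  refine ae_eq_of_integral_contDiff_smul_eq
    ((Lp.memLp _).locallyIntegrable (by norm_num)) hcont.locallyIntegrable fun φ hφ hc => ?_
  have hφ' : ContDiff ℝ (⊤ : ℕ∞) fun x => (φ x : ℂ) := Complex.ofRealCLM.contDiff.comp hφ
  have hc' : HasCompactSupport fun x => (φ x : ℂ) := hc.comp_left (g := Complex.ofReal) (by simp)
  let ψ : SchwartzMap ℝ ℂ := hc'.toSchwartzMap hφ'
  have hψ : ∀ x, ψ x = φ x := fun x => rfl
  have e1 : Lp.toTemperedDistribution (𝓕 (h2.toLp f) : L2R) ψ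
      = ∫ x, φ x • (𝓕 (h2.toLp f) : L2R) x := by
    rw [Lp.toTemperedDistribution_apply]
    simp [hψ]
  rw [← e1, ← Lp.fourier_toTemperedDistribution_eq, TemperedDistribution.fourier_apply,
    Lp.toTemperedDistribution_apply]
  have e2 : ∫ x, (𝓕 ψ) x • (h2.toLp f) x = ∫ x, (𝓕 ψ) x • f x := by
    refine integral_congr_ae ?_
    filter_upwards [h2.coeFn_toLp] with x hx
    rw [hx]
  rw [e2]
  have e3 := VectorFourier.integral_fourierIntegral_smul_eq_flip (μ := volume) (ν := volume)
    (L := innerₗ ℝ) (f := ψ) (g := f) Real.continuous_fourierChar continuous_inner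
    ψ.integrable h1
  have e4 : (innerₗ ℝ).flip = innerₗ ℝ := by ext; simp
  rw [e4] at e3
  calc _ = _ := e3
    _ = _ := by
      refine integral_congr_ae (Filter.Eventually.of_forall fun x => ?_)
      simp only [hψ]
      rfl

theorem eLpNorm_two_sq {α : Type*} [MeasurableSpace α] (F : α → ℂ) (μ : Measure α) :
    eLpNorm F 2 μ ^ 2 = ∫⁻ y, ‖F y‖ₑ ^ 2 ∂μ := by
  rw [eLpNorm_eq_lintegral_rpow_enorm_toReal (by norm_num) (by norm_num), ← ENNReal.rpow_natCast,
    ← ENNReal.rpow_mul]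
  simp

/-- Plancherel's theorem for functions in `L¹ ∩ L²`. -/
theorem lintegral_enorm_fourier_sq {f : ℝ → ℂ} (h1 : Integrable f) (h2 : MemLp f 2 volume) :
    ∫⁻ y, ‖𝓕 f y‖ₑ ^ 2 = ∫⁻ t, ‖f t‖ₑ ^ 2 := by
  rw [← eLpNorm_two_sq, ← eLpNorm_two_sq, ← eLpNorm_congr_ae (coeFn_fourier_toLp_ae h1 h2), ← Lp.enorm_def,
    ← ofReal_norm, Lp.norm_fourier_eq, ofReal_norm, Lp.enorm_toLp]

theorem lintegral_enorm_sq_L2R (f : L2R) : ∫⁻ t, ‖f t‖ₑ ^ 2 = ‖f‖ₑ ^ 2 := by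
  rw [← eLpNorm_two_sq, Lp.enorm_def]

theorem gaborTransform_eq_fourier (g f : L2R) (x y : ℝ) :
    gaborTransform g f ⟨x, y⟩ = 𝓕 (fun t : ℝ => f t * conj (g (t - x))) (-y) := by
  rw [gaborTransform_eq_integral, Real.fourier_real_eq_integral_exp_smul]
  refine integral_congr_ae (Filter.Eventually.of_forall fun t => ?_)
  have : conj (Complex.exp (-2 * Real.pi * Complex.I * y * t))
      = Complex.exp (((-2 * Real.pi * t * -y : ℝ) : ℂ) * Complex.I) := by
    rw [← Complex.exp_conj]
    congr 1
    simp only [map_mul, map_neg, Complex.conj_ofReal, Complex.conj_I, map_ofNat]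
    push_cast
    ring
  simp only [map_mul, this, smul_eq_mul]
  ring

theorem lintegral_lintegral_enorm_sq (g f : L2R) :
    ∫⁻ x : ℝ, ∫⁻ t : ℝ, ‖f t * conj (g (t - x))‖ₑ ^ 2 = ‖f‖ₑ ^ 2 * ‖g‖ₑ ^ 2 := by
  have hg := (Lp.stronglyMeasurable g).measurable
  have hf := (Lp.stronglyMeasurable f).measurable
  rw [lintegral_lintegral_swap]
  · have h1 : ∀ t : ℝ, ∫⁻ x : ℝ, ‖f t * conj (g (t - x))‖ₑ ^ 2 = ‖f t‖ₑ ^ 2 * ‖g‖ₑ ^ 2 := by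
      intro t
      have h2 : ∀ x : ℝ, ‖f t * conj (g (t - x))‖ₑ ^ 2 = ‖f t‖ₑ ^ 2 * ‖g (t - x)‖ₑ ^ 2 := by
        intro x
        rw [enorm_mul, mul_pow, RCLike.enorm_conj]
      simp_rw [h2]
      rw [lintegral_const_mul _ (by fun_prop),
        lintegral_sub_left_eq_self (fun x => ‖g x‖ₑ ^ 2) t, lintegral_enorm_sq_L2R]
    simp_rw [h1]
    rw [lintegral_mul_const _ (by fun_prop), lintegral_enorm_sq_L2R]
  · apply Measurable.aemeasurable
    refine Measurable.pow_const (Measurable.enorm ?_) 2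
    exact (hf.comp measurable_snd).mul
      (Complex.continuous_conj.measurable.comp (hg.comp (measurable_snd.sub measurable_fst)))

/-- Moyal's identity for the norm of a Gabor transform. -/
theorem lintegral_enorm_gaborTransform_sq (g f : L2R) :
    ∫⁻ z, ‖gaborTransform g f z‖ₑ ^ 2 = ‖f‖ₑ ^ 2 * ‖g‖ₑ ^ 2 := by
  have hg := (Lp.stronglyMeasurable g).measurable
  have hf := (Lp.stronglyMeasurable f).measurable
  have hm : Measurable fun z => ‖gaborTransform g f z‖ₑ ^ 2 :=
    (continuous_gaborTransform g f).measurable.enorm.pow_const 2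
  have e1 : ∫⁻ z, ‖gaborTransform g f z‖ₑ ^ 2
      = ∫⁻ x : ℝ, ∫⁻ y : ℝ, ‖gaborTransform g f ⟨x, y⟩‖ₑ ^ 2 := by
    rw [← (Complex.volume_preserving_equiv_real_prod.symm).lintegral_comp hm,
      Measure.volume_eq_prod, lintegral_prod]
    · rfl
    · exact (hm.comp Complex.measurableEquivRealProd.symm.measurable).aemeasurable
  rw [e1, ← lintegral_lintegral_enorm_sq]
  have hm2 : Measurable fun p : ℝ × ℝ => ‖f p.2 * conj (g (p.2 - p.1))‖ₑ ^ 2 := by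
    refine Measurable.pow_const (Measurable.enorm ?_) 2
    exact (hf.comp measurable_snd).mul
      (Complex.continuous_conj.measurable.comp (hg.comp (measurable_snd.sub measurable_fst)))
  -- The product of two `L²` functions is always in `L¹`, but in `L²` only for almost every `x`;
  -- Plancherel needs both.
  have hfin : ∀ᵐ x : ℝ, ∫⁻ t : ℝ, ‖f t * conj (g (t - x))‖ₑ ^ 2 < ∞ := by
    refine ae_lt_top hm2.lintegral_prod_right' ?_
    rw [lintegral_lintegral_enorm_sq]
    exact ENNReal.mul_ne_top (by simp) (by simp)
  refine lintegral_congr_ae ?_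
  filter_upwards [hfin] with x hx
  have hmx : AEStronglyMeasurable (fun t : ℝ => f t * conj (g (t - x))) volume :=
    (hf.mul (Complex.continuous_conj.measurable.comp
      (hg.comp (measurable_id.sub_const x)))).aestronglyMeasurable
  have hgx : MemLp (fun t : ℝ => conj (g (t - x))) 2 volume :=
    ((Lp.memLp g).comp_measurePreserving (measurePreserving_sub_right volume x)).star
  have hL1 : Integrable (fun t : ℝ => f t * conj (g (t - x))) := (Lp.memLp f).integrable_mul hgx
  have hL2 : MemLp (fun t : ℝ => f t * conj (g (t - x))) 2 volume := by
    refine ⟨hmx, ?_⟩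
    rw [← eLpNorm_two_sq] at hx
    exact lt_top_iff_ne_top.2 fun h => by simp [h] at hx
  rw [← lintegral_enorm_fourier_sq hL1 hL2]
  simp_rw [gaborTransform_eq_fourier]
  exact lintegral_neg_eq_self (μ := volume)
    (fun y => ‖𝓕 (fun t : ℝ => f t * conj (g (t - x))) y‖ₑ ^ 2)

theorem eLpNorm_gaborTransform (g f : L2R) :
    eLpNorm (gaborTransform g f) 2 volume = ‖f‖ₑ * ‖g‖ₑ := by
  refine (ENNReal.pow_right_strictMono two_ne_zero).injective ?_
  rw [eLpNorm_two_sq, lintegral_enorm_gaborTransform_sq, mul_pow]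

theorem memLp_gaborTransform (g f : L2R) : MemLp (gaborTransform g f) 2 volume := by
  refine ⟨(continuous_gaborTransform g f).aestronglyMeasurable, ?_⟩
  rw [eLpNorm_gaborTransform]
  exact ENNReal.mul_lt_top (by simp) (by simp)

/-- The Gabor transform as an element of `L²(ℂ)`. -/
noncomputable def gaborLp (g f : L2R) : Lp ℂ 2 (volume : Measure ℂ) :=
  (memLp_gaborTransform g f).toLp _

theorem norm_gaborLp (g f : L2R) : ‖gaborLp g f‖ = ‖f‖ * ‖g‖ := by
  rw [gaborLp, Lp.norm_toLp, eLpNorm_gaborTransform, ENNReal.toReal_mul, toReal_enorm, toReal_enorm]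

theorem gaborLp_eq {g f : L2R} {F : ℂ → ℂ} (hF : MemLp F 2 volume)
    (h : ∀ z, gaborTransform g f z = F z) : gaborLp g f = hF.toLp F :=
  MemLp.toLp_congr _ _ (Filter.Eventually.of_forall h)

theorem gaborLp_add_right (g f₁ f₂ : L2R) :
    gaborLp g (f₁ + f₂) = gaborLp g f₁ + gaborLp g f₂ :=
  gaborLp_eq ((memLp_gaborTransform g f₁).add (memLp_gaborTransform g f₂)) fun z => by
    simp [gaborTransform, inner_add_right]

theorem gaborLp_smul_right (g f : L2R) (c : ℂ) : gaborLp g (c • f) = c • gaborLp g f :=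
  gaborLp_eq ((memLp_gaborTransform g f).const_smul c) fun z => by
    simp [gaborTransform, inner_smul_right]

theorem gaborLp_add_left (g₁ g₂ f : L2R) :
    gaborLp (g₁ + g₂) f = gaborLp g₁ f + gaborLp g₂ f :=
  gaborLp_eq ((memLp_gaborTransform g₁ f).add (memLp_gaborTransform g₂ f)) fun z => by
    simp [gaborTransform, inner_add_left, atom_add]

theorem gaborLp_smul_left (g f : L2R) (c : ℂ) : gaborLp (c • g) f = conj c • gaborLp g f :=
  gaborLp_eq ((memLp_gaborTransform g f).const_smul (conj c)) fun z => by
    simp [gaborTransform, inner_smul_left, atom_smul]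

theorem gaborLp_sub_right (g f₁ f₂ : L2R) :
    gaborLp g (f₁ - f₂) = gaborLp g f₁ - gaborLp g f₂ := by
  rw [sub_eq_add_neg, ← neg_one_smul ℂ f₂, gaborLp_add_right, gaborLp_smul_right, neg_one_smul,
    ← sub_eq_add_neg]

theorem inner_gaborLp_same (g f₁ f₂ : L2R) :
    inner ℂ (gaborLp g f₁) (gaborLp g f₂) = inner ℂ f₁ f₂ * inner ℂ g g := by
  rw [inner_eq_sum_norm_sq_div_four (gaborLp g f₁), inner_eq_sum_norm_sq_div_four f₁,
    ← gaborLp_smul_right, ← gaborLp_add_right, ← gaborLp_add_right, ← gaborLp_sub_right,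
    ← gaborLp_sub_right, inner_self_eq_norm_sq_to_K]
  simp only [norm_gaborLp]
  push_cast
  ring

/-- Moyal's identity. -/
theorem inner_gaborLp (g₁ g₂ f₁ f₂ : L2R) :
    inner ℂ (gaborLp g₁ f₁) (gaborLp g₂ f₂) = inner ℂ f₁ f₂ * inner ℂ g₂ g₁ := by
  have h1 := inner_gaborLp_same (g₁ + g₂) f₁ f₂
  have h2 := inner_gaborLp_same (g₁ + Complex.I • g₂) f₁ f₂
  have h3 := inner_gaborLp_same g₁ f₁ f₂
  have h4 := inner_gaborLp_same g₂ f₁ f₂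
  simp only [gaborLp_add_left, gaborLp_smul_left, inner_add_left, inner_add_right,
    inner_smul_left, inner_smul_right, Complex.conj_I, map_neg] at h1 h2
  -- Polarization in the window: `g₁ + g₂` and `g₁ + i g₂` give two equations in the two cross
  -- terms, and this combination isolates one of them.
  linear_combination (norm := (ring_nf; simp only [Complex.I_sq, Complex.I_pow_three]; ring)) (1 / 2 : ℂ) * h1 + (Complex.I / 2) * h2
    - ((1 + Complex.I) / 2) * h3
    - ((1 + Complex.I) / 2) * h4

/-! ### The averaged window and its integrable majorant. -/

theorem norm_gaborTransform_le (g f : L2R) (z : ℂ) : ‖gaborTransform g f z‖ ≤ ‖g‖ * ‖f‖ :=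
  (norm_inner_le_norm _ _).trans_eq (by rw [norm_atom])

theorem gaborTransform_self_zero (g : L2R) : gaborTransform g g 0 = inner ℂ g g := by
  rw [gaborTransform, atom_zero]

/-- The window `∫ k(z) g_z dz`, where `z` ranges over the unit disc and `k(z) = ⟨g, g_z⟩`. -/
noncomputable def averagedWindow (g : L2R) : L2R :=
  ∫ z in Metric.ball (0 : ℂ) 1, gaborTransform g g z • atom g z

theorem inner_averagedWindow (g a : L2R) :
    inner ℂ a (averagedWindow g) =
      ∫ z in Metric.ball (0 : ℂ) 1, gaborTransform g g z * inner ℂ a (atom g z) := by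
  have hi : IntegrableOn (fun z => gaborTransform g g z • atom g z) (Metric.ball (0 : ℂ) 1) :=
    ((continuous_gaborTransform g g).smul (continuous_atom g)).continuousOn.integrableOn_compact
      (isCompact_closedBall (0 : ℂ) 1) |>.mono_set Metric.ball_subset_closedBall
  rw [averagedWindow, ← integral_inner hi]
  simp_rw [inner_smul_right]

/-- The weight `k(z)` turns the inner product into the integral of `|k|²` over the disc, which is
positive since `k` is continuous and `k(0) = ‖g‖²`. -/
theorem inner_averagedWindow_ne_zero {g : L2R} (h0 : g ≠ 0) :
    inner ℂ g (averagedWindow g) ≠ 0 := by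
  have h1 : ∀ z, gaborTransform g g z * inner ℂ g (atom g z)
      = ((‖gaborTransform g g z‖ ^ 2 : ℝ) : ℂ) := by
    intro z
    rw [← inner_conj_symm g, ← gaborTransform, Complex.mul_conj, Complex.normSq_eq_norm_sq]
  rw [inner_averagedWindow]
  simp_rw [h1]
  rw [integral_complex_ofReal]
  have hc : Continuous fun z => ‖gaborTransform g g z‖ ^ 2 :=
    (continuous_gaborTransform g g).norm.pow 2
  have hpos : 0 < ∫ z in Metric.ball (0 : ℂ) 1, ‖gaborTransform g g z‖ ^ 2 := by
    rw [setIntegral_pos_iff_support_of_nonneg_ae]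
    · refine (hc.isOpen_support.inter Metric.isOpen_ball).measure_pos _ ⟨0, ?_, by simp⟩
      simp [gaborTransform_self_zero, h0]
    · exact Filter.Eventually.of_forall fun z => by positivity
    · exact hc.continuousOn.integrableOn_compact (isCompact_closedBall (0 : ℂ) 1)
        |>.mono_set Metric.ball_subset_closedBall
  exact_mod_cast hpos.ne'

/-- The local averages of `|k|`, which dominate the Gabor transforms of `g_u`, `|u| ≤ 1`, with
respect to the averaged window. -/
noncomputable def localAverage (g : L2R) (ζ : ℂ) : ℝ≥0∞ :=
  ‖g‖ₑ ^ 2 * ∫⁻ v in Metric.ball (0 : ℂ) 2, ‖gaborTransform g g (ζ + v)‖ₑ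

theorem measurable_enorm_gaborTransform_add (g : L2R) :
    Measurable fun p : ℂ × ℂ => ‖gaborTransform g g (p.1 + p.2)‖ₑ :=
  ((continuous_gaborTransform g g).comp (continuous_fst.add continuous_snd)).measurable.enorm

theorem measurable_localAverage (g : L2R) : Measurable (localAverage g) :=
  (measurable_enorm_gaborTransform_add g).lintegral_prod_right'.const_mul _

theorem lintegral_localAverage_ne_top {g : L2R} (hg : g ∈ feichtingerAlgebra) :
    ∫⁻ ζ, localAverage g ζ ≠ ∞ := by
  have hm := measurable_enorm_gaborTransform_add g
  simp only [localAverage]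
  rw [lintegral_const_mul _ hm.lintegral_prod_right', lintegral_lintegral_swap hm.aemeasurable]
  have hv : ∀ v : ℂ, ∫⁻ ζ, ‖gaborTransform g g (ζ + v)‖ₑ = ∫⁻ ζ, ‖gaborTransform g g ζ‖ₑ :=
    fun v => lintegral_add_right_eq_self (fun ζ => ‖gaborTransform g g ζ‖ₑ) v
  simp_rw [hv]
  rw [lintegral_const]
  refine ENNReal.mul_ne_top (by simp) (ENNReal.mul_ne_top hg.2.ne ?_)
  rw [Measure.restrict_apply_univ]
  exact measure_ball_lt_top.ne

/-- The left side is at most the integral of `|k(z)| |k(ζ + z - u)|` over the unit disc. Bound the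
first factor by `‖g‖²` and substitute `v = z - u`, which lies in the disc of radius 2 whatever `u`
is. -/
theorem enorm_inner_averagedWindow_le (g : L2R) {u : ℂ} (hu : ‖u‖ ≤ 1) (ζ : ℂ) :
    ‖inner ℂ (atom (averagedWindow g) ζ) (atom g u)‖ₑ ≤ localAverage g ζ := by
  have h1 : ‖inner ℂ (atom (averagedWindow g) ζ) (atom g u)‖ₑ
      = ‖inner ℂ (atom (atom g u) (-ζ)) (averagedWindow g)‖ₑ := by
    rw [← ofReal_norm, norm_inner_atom_comm, norm_inner_symm, ofReal_norm]
  have h2 : ∀ z, ‖inner ℂ (atom (atom g u) (-ζ)) (atom g z)‖ₑ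
      = ‖gaborTransform g g (ζ + (z - u))‖ₑ := by
    intro z
    rw [← ofReal_norm, norm_inner_atom_atom_left, norm_inner_symm, ← neg_neg (u + -ζ),
      ← norm_inner_atom_comm, norm_inner_atom_atom_left, ofReal_norm, gaborTransform]
    congr 3
    ring
  rw [h1, inner_averagedWindow, localAverage]
  refine (enorm_integral_le_lintegral_enorm _).trans ?_
  calc ∫⁻ z in Metric.ball (0 : ℂ) 1,
        ‖gaborTransform g g z * inner ℂ (atom (atom g u) (-ζ)) (atom g z)‖ₑ
      ≤ ∫⁻ z in Metric.ball (0 : ℂ) 1, ‖g‖ₑ ^ 2 * ‖gaborTransform g g (ζ + (z - u))‖ₑ := by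
        refine lintegral_mono fun z => ?_
        rw [enorm_mul, h2]
        gcongr
        rw [← ofReal_norm, ← ofReal_norm, ← ENNReal.ofReal_pow (norm_nonneg _), sq]
        exact ENNReal.ofReal_le_ofReal (norm_gaborTransform_le g g z)
    _ = ‖g‖ₑ ^ 2 * ∫⁻ z in Metric.ball (0 : ℂ) 1, ‖gaborTransform g g (ζ + (z - u))‖ₑ := by
        refine lintegral_const_mul _ (Continuous.measurable ?_).enorm
        exact (continuous_gaborTransform g g).comp (by fun_prop)
    _ ≤ _ := by
        refine mul_le_mul_right ?_ _
        rw [← lintegral_indicator measurableSet_ball, ← lintegral_indicator measurableSet_ball,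
          ← lintegral_sub_right_eq_self ((Metric.ball (0 : ℂ) 2).indicator _) u]
        refine lintegral_mono fun z => ?_
        by_cases hz : z ∈ Metric.ball (0 : ℂ) 1
        · have hzu : z - u ∈ Metric.ball (0 : ℂ) 2 := by
            rw [mem_ball_zero_iff] at hz ⊢
            linarith [norm_sub_le z u]
          rw [indicator_of_mem hz, indicator_of_mem hzu]
        · rw [indicator_of_notMem hz]
          exact zero_le

theorem exists_dominated_perturbation {g : L2R} (hg : g ∈ feichtingerAlgebra) {η : ℝ≥0∞}
    (hη : η ≠ 0) :
    ∃ δ : ℝ, 0 < δ ∧ ∃ Φ : ℂ → ℝ≥0∞, Measurable Φ ∧ ∫⁻ ζ, Φ ζ ≤ η ∧ ∀ u : ℂ, ‖u‖ < δ →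
      ∀ ζ, ‖inner ℂ (atom (averagedWindow g) ζ) (atom g u - g)‖ₑ ≤ Φ ζ := by
  set h := averagedWindow g
  have hm := measurable_localAverage g
  -- The first entry of the minimum is an integrable majorant; the second, a bound for `‖g_u - g‖ ≤
  -- 1/n`, tends to zero pointwise.
  have hlim : Filter.Tendsto (fun n : ℕ => ∫⁻ ζ, min (2 * localAverage g ζ) (‖h‖ₑ * (n : ℝ≥0∞)⁻¹))
      Filter.atTop (nhds (∫⁻ _ : ℂ, 0)) := by
    refine tendsto_lintegral_of_dominated_convergence (fun ζ => 2 * localAverage g ζ)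
      (fun n => (hm.const_mul 2).min measurable_const)
      (fun n => Filter.Eventually.of_forall fun ζ => min_le_left _ _) ?_
      (Filter.Eventually.of_forall fun ζ => ?_)
    · rw [lintegral_const_mul _ hm]
      exact ENNReal.mul_ne_top (by simp) (lintegral_localAverage_ne_top hg)
    · have h1 : Filter.Tendsto (fun n : ℕ => ‖h‖ₑ * (n : ℝ≥0∞)⁻¹) Filter.atTop (nhds 0) := by
        simpa using ENNReal.Tendsto.const_mul ENNReal.tendsto_inv_nat_nhds_zero
          (Or.inr (enorm_ne_top (x := h)))
      exact tendsto_of_tendsto_of_tendsto_of_le_of_le tendsto_const_nhds h1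
        (fun _ => zero_le) (fun n => min_le_right _ _)
  rw [lintegral_zero] at hlim
  obtain ⟨n, hn, hn0⟩ := ((hlim.eventually_lt_const (pos_iff_ne_zero.2 hη)).and
    (Filter.eventually_gt_atTop 0)).exists
  have hcont : Filter.Tendsto (fun u : ℂ => ‖atom g u - g‖ₑ) (nhds 0) (nhds 0) := by
    have := ((continuous_atom g).sub (continuous_const (y := g))).enorm.tendsto 0
    simpa [atom_zero] using this
  have hev := hcont.eventually_lt_const (u := (n : ℝ≥0∞)⁻¹) (by simp)
  obtain ⟨δ, hδ, hball⟩ := Metric.eventually_nhds_iff.1 hev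
  refine ⟨min δ 1, by positivity, _, (hm.const_mul 2).min measurable_const, hn.le,
    fun u hu ζ => le_min ?_ ?_⟩
  · rw [inner_sub_right, two_mul]
    refine enorm_sub_le.trans (add_le_add ?_ ?_)
    · exact enorm_inner_averagedWindow_le g (hu.le.trans (min_le_right _ _)) ζ
    · have := enorm_inner_averagedWindow_le g (u := 0) (by simp) ζ
      rwa [atom_zero] at this
  · have h2 : ‖inner ℂ (atom h ζ) (atom g u - g)‖ₑ ≤ ‖h‖ₑ * ‖atom g u - g‖ₑ := by
      rw [← ofReal_norm, ← ofReal_norm, ← ofReal_norm, ← ENNReal.ofReal_mul (norm_nonneg _)]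
      exact ENNReal.ofReal_le_ofReal ((norm_inner_le_norm _ _).trans_eq (by rw [norm_atom]))
    refine h2.trans ?_
    gcongr
    exact (hball (by simpa using hu.trans_le (min_le_left _ _))).le

/-! ### Perturbation of Gabor frames. -/

/-- Moyal's identity for the windows `h`, `g` and the functions `a`, `f_{-z}`. This is a reproducing
formula with the phases discarded. -/
theorem enorm_inner_mul_le_lintegral (g h a f : L2R) (z : ℂ) :
    ‖inner ℂ g h‖ₑ * ‖inner ℂ (atom a z) f‖ₑ ≤
      ∫⁻ ζ, ‖inner ℂ (atom h ζ) a‖ₑ * ‖inner ℂ (atom g (ζ + z)) f‖ₑ := by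
  have h1 := inner_gaborLp h g a (atom f (-z))
  have h2 : ‖inner ℂ (atom a z) f‖ₑ = ‖inner ℂ a (atom f (-z))‖ₑ := by
    rw [← ofReal_norm, norm_inner_atom_comm, ofReal_norm]
  rw [h2, mul_comm, ← enorm_mul, ← h1, L2.inner_def]
  refine (enorm_integral_le_lintegral_enorm _).trans_eq (lintegral_congr_ae ?_)
  filter_upwards [(memLp_gaborTransform h a).coeFn_toLp,
    (memLp_gaborTransform g (atom f (-z))).coeFn_toLp] with ζ h3 h4
  rw [gaborLp, gaborLp, h3, h4, RCLike.inner_apply', enorm_mul, RCLike.enorm_conj,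
    gaborTransform, gaborTransform]
  congr 1
  rw [← ofReal_norm, ← norm_inner_atom_comm, norm_inner_atom_atom_left, ofReal_norm]

theorem sq_lintegral_mul_le {α : Type*} [MeasurableSpace α] {μ : Measure α} {Φ F : α → ℝ≥0∞}
    (hΦ : Measurable Φ) (hF : Measurable F) :
    (∫⁻ x, Φ x * F x ∂μ) ^ 2 ≤ (∫⁻ x, Φ x ∂μ) * ∫⁻ x, Φ x * F x ^ 2 ∂μ := by
  have h := ENNReal.lintegral_mul_le_Lp_mul_Lq μ Real.HolderConjugate.two_two
    (f := fun x => Φ x ^ (1 / 2 : ℝ)) (g := fun x => Φ x ^ (1 / 2 : ℝ) * F x)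
    (hΦ.pow_const _).aemeasurable ((hΦ.pow_const _).mul hF).aemeasurable
  have e0 : ∀ a : ℝ≥0∞, (a ^ (1 / 2 : ℝ)) ^ (2 : ℝ) = a := fun a => by
    rw [← ENNReal.rpow_mul]; simp
  have e1 : ∀ a : ℝ≥0∞, (a ^ (1 / 2 : ℝ)) ^ 2 = a := fun a => by
    rw [← ENNReal.rpow_natCast, ← ENNReal.rpow_mul]; simp
  have e2 : ∀ x, Φ x ^ (1 / 2 : ℝ) * (Φ x ^ (1 / 2 : ℝ) * F x) = Φ x * F x := fun x => by
    rw [← mul_assoc, ← sq, e1]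
  simp only [Pi.mul_apply, e2, ENNReal.mul_rpow_of_nonneg _ _ zero_le_two, e0,
    ENNReal.rpow_two] at h
  calc _ ≤ _ := pow_le_pow_left' h 2
    _ = _ := by rw [mul_pow, e1, e1]

/-- Cauchy–Schwarz for the measure `Φ dζ` brings the square inside. For each `ζ` the shift of the
points moves onto `f` and preserves its norm, so the same Bessel bound applies. -/
theorem tsum_sq_lintegral_le {g : L2R} {z : ℕ → ℂ} {B : ℝ≥0∞}
    (hB : ∀ f : L2R, ∑' j, ‖inner ℂ (atom g (z j)) f‖ₑ ^ 2 ≤ B * ‖f‖ₑ ^ 2)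
    {Φ : ℂ → ℝ≥0∞} (hΦ : Measurable Φ) (f : L2R) :
    ∑' j, (∫⁻ ζ, Φ ζ * ‖inner ℂ (atom g (ζ + z j)) f‖ₑ) ^ 2
      ≤ (∫⁻ ζ, Φ ζ) ^ 2 * (B * ‖f‖ₑ ^ 2) := by
  have hm : ∀ j, Measurable fun ζ => ‖inner ℂ (atom g (ζ + z j)) f‖ₑ := fun j =>
    ((continuous_gaborTransform g f).comp (continuous_add_const (z j))).measurable.enorm
  calc _ ≤ ∑' j, (∫⁻ ζ, Φ ζ) * ∫⁻ ζ, Φ ζ * ‖inner ℂ (atom g (ζ + z j)) f‖ₑ ^ 2 :=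
        ENNReal.tsum_le_tsum fun j => sq_lintegral_mul_le hΦ (hm j)
    _ = (∫⁻ ζ, Φ ζ) * ∫⁻ ζ, Φ ζ * ∑' j, ‖inner ℂ (atom g (ζ + z j)) f‖ₑ ^ 2 := by
        have h1 := lintegral_tsum (μ := volume)
          fun j => (hΦ.mul ((hm j).pow_const 2)).aemeasurable
        simp only [Pi.mul_apply, ENNReal.tsum_mul_left] at h1
        rw [ENNReal.tsum_mul_left, h1]
    _ ≤ (∫⁻ ζ, Φ ζ) * ∫⁻ ζ, Φ ζ * (B * ‖f‖ₑ ^ 2) := by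
        gcongr with ζ
        have h1 : ∀ j, ‖inner ℂ (atom g (ζ + z j)) f‖ₑ
            = ‖inner ℂ (atom g (z j)) (atom f (-ζ))‖ₑ := fun j => by
          rw [← ofReal_norm, ← ofReal_norm, ← norm_inner_atom_comm, norm_inner_atom_atom_left,
            add_comm]
        have h2 : ‖atom f (-ζ)‖ₑ = ‖f‖ₑ := by rw [← ofReal_norm, norm_atom, ofReal_norm]
        simp_rw [h1]
        exact (hB _).trans_eq (by rw [h2])
    _ = _ := by rw [lintegral_mul_const _ hΦ]; ring

theorem add_sq_le_two_mul (a b : ℝ≥0∞) : (a + b) ^ 2 ≤ 2 * a ^ 2 + 2 * b ^ 2 := by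
  have h := ENNReal.rpow_add_le_mul_rpow_add_rpow a b (p := 2) (by norm_num)
  norm_num at h
  rwa [mul_add] at h

/-- The Gabor frame property is stable under small perturbations. -/
theorem exists_isFrame_perturbation {g : L2R} (h0 : g ≠ 0) (hg : g ∈ feichtingerAlgebra)
    {z : ℕ → ℂ} (hz : IsFrame fun j => atom g (z j)) :
    ∃ δ : ℝ, 0 < δ ∧ ∀ w : ℕ → ℂ, (∀ j, ‖z j - w j‖ < δ) → IsFrame fun j => atom g (w j) := by
  obtain ⟨A, B, hA, hB, hAB⟩ := hz
  set α : ℝ≥0∞ := ‖inner ℂ g (averagedWindow g)‖ₑ with hα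
  have hα0 : α ≠ 0 := by simpa [hα] using inner_averagedWindow_ne_zero h0
  have hαt : α ≠ ∞ := enorm_ne_top
  -- `A / 4` survives the factor 2 in `(a + b)² ≤ 2a² + 2b²`: from `A ≤ 2S + 2(A / 4)`, for `‖f‖ =
  -- 1`, there remains `S ≥ A / 4`.
  obtain ⟨ε, hε0, hε⟩ : ∃ ε : ℝ≥0∞, ε ≠ 0 ∧ ε ^ 2 * ENNReal.ofReal B ≤ ENNReal.ofReal (A / 4) := by
    refine ⟨ENNReal.ofReal (Real.sqrt (A / 4 / B)), by simp; positivity, ?_⟩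
    rw [← ENNReal.ofReal_pow (by positivity), ← ENNReal.ofReal_mul (by positivity),
      Real.sq_sqrt (by positivity), div_mul_cancel₀ _ hB.ne']
  obtain ⟨δ, hδ, Φ, hΦ, hΦi, hΦu⟩ := exists_dominated_perturbation hg (mul_ne_zero hα0 hε0)
  refine ⟨δ, hδ, fun w hw => ?_⟩
  set d : L2R → ℕ → ℝ≥0∞ := fun f j => ‖inner ℂ (atom (atom g (w j - z j) - g) (z j)) f‖ₑ with hd
  have hdsum : ∀ f, ∑' j, d f j ^ 2 ≤ ENNReal.ofReal (A / 4) * ‖f‖ₑ ^ 2 := by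
    intro f
    have h1 : α ^ 2 * ∑' j, d f j ^ 2 ≤ α ^ 2 * (ENNReal.ofReal (A / 4) * ‖f‖ₑ ^ 2) := by
      calc α ^ 2 * ∑' j, d f j ^ 2 = ∑' j, (α * d f j) ^ 2 := by
            simp_rw [mul_pow, ENNReal.tsum_mul_left]
        _ ≤ ∑' j, (∫⁻ ζ, Φ ζ * ‖inner ℂ (atom g (ζ + z j)) f‖ₑ) ^ 2 := by
            refine ENNReal.tsum_le_tsum fun j => ?_
            gcongr
            refine (enorm_inner_mul_le_lintegral g _ _ f (z j)).trans ?_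
            gcongr with ζ
            exact hΦu _ (by rw [norm_sub_rev]; exact hw j) ζ
        _ ≤ (∫⁻ ζ, Φ ζ) ^ 2 * (ENNReal.ofReal B * ‖f‖ₑ ^ 2) :=
            tsum_sq_lintegral_le (fun f => (hAB f).2) hΦ f
        _ ≤ (α * ε) ^ 2 * (ENNReal.ofReal B * ‖f‖ₑ ^ 2) := by gcongr
        _ = α ^ 2 * ((ε ^ 2 * ENNReal.ofReal B) * ‖f‖ₑ ^ 2) := by ring
        _ ≤ _ := by gcongr
    exact (ENNReal.mul_le_mul_iff_right (pow_ne_zero 2 hα0) (ENNReal.pow_ne_top hαt)).1 h1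
  have hdeq : ∀ f j, inner ℂ (atom (atom g (w j - z j) - g) (z j)) f
      = conj (phase (w j - z j) (z j)) * inner ℂ (atom g (w j)) f - inner ℂ (atom g (z j)) f := by
    intro f j
    rw [atom_sub, inner_sub_left, atom_atom, inner_smul_left, sub_add_cancel]
  have hph : ∀ f j, ‖conj (phase (w j - z j) (z j)) * inner ℂ (atom g (w j)) f‖ₑ
      = ‖inner ℂ (atom g (w j)) f‖ₑ := by
    intro f j
    rw [← ofReal_norm, norm_mul, RCLike.norm_conj, norm_phase, one_mul, ofReal_norm]
  refine ⟨A / 4, 2 * B + A / 2, by positivity, by positivity, fun f => ⟨?_, ?_⟩⟩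
  · have h1 : ∑' j, ‖inner ℂ (atom g (z j)) f‖ₑ ^ 2
        ≤ 2 * (∑' j, ‖inner ℂ (atom g (w j)) f‖ₑ ^ 2) + 2 * ∑' j, d f j ^ 2 := by
      rw [← ENNReal.tsum_mul_left, ← ENNReal.tsum_mul_left, ← ENNReal.tsum_add]
      refine ENNReal.tsum_le_tsum fun j => le_trans ?_ (add_sq_le_two_mul _ _)
      gcongr
      rw [← hph f j]
      simp only [hd, hdeq]
      refine le_trans (le_of_eq ?_) enorm_sub_le
      congr 1; ring
    have hft : ‖f‖ₑ ^ 2 ≠ ∞ := by simp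
    have h2 := ((hAB f).1.trans h1).trans (add_le_add_right (mul_le_mul_right (hdsum f) 2) _)
    rcases eq_or_ne (∑' j, ‖inner ℂ (atom g (w j)) f‖ₑ ^ 2) ∞ with hS | hS
    · rw [hS]; exact le_top
    · lift (∑' j, ‖inner ℂ (atom g (w j)) f‖ₑ ^ 2) to NNReal using hS with S
      lift ‖f‖ₑ ^ 2 to NNReal using hft with N
      simp only [ENNReal.ofReal] at h2 ⊢
      norm_cast at h2 ⊢
      rw [← NNReal.coe_le_coe] at h2 ⊢
      push_cast [Real.coe_toNNReal _ hA.le, Real.coe_toNNReal _ (by positivity : 0 ≤ A / 4)]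
        at h2 ⊢
      linarith
  · have h1 : ∑' j, ‖inner ℂ (atom g (w j)) f‖ₑ ^ 2
        ≤ 2 * (∑' j, ‖inner ℂ (atom g (z j)) f‖ₑ ^ 2) + 2 * ∑' j, d f j ^ 2 := by
      rw [← ENNReal.tsum_mul_left, ← ENNReal.tsum_mul_left, ← ENNReal.tsum_add]
      refine ENNReal.tsum_le_tsum fun j => le_trans ?_ (add_sq_le_two_mul _ _)
      gcongr
      rw [← hph f j]
      simp only [hd, hdeq]
      refine le_trans (le_of_eq ?_) (enorm_add_le _ _)
      congr 1; ring
    calc _ ≤ _ := h1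
      _ ≤ 2 * (ENNReal.ofReal B * ‖f‖ₑ ^ 2) + 2 * (ENNReal.ofReal (A / 4) * ‖f‖ₑ ^ 2) := by
        gcongr
        · exact (hAB f).2
        · exact hdsum f
      _ = _ := by
        rw [ENNReal.ofReal_add (by positivity) (by positivity), ENNReal.ofReal_mul zero_le_two,
          show A / 2 = 2 * (A / 4) by ring, ENNReal.ofReal_mul zero_le_two, ENNReal.ofReal_ofNat]
        ring

/-! ### From frames to sampling sets. -/

theorem isSamplingFamily_iff_isFrame {ι : Type*} {g : L2R} (hnorm : ‖g‖ = 1) (z : ι → ℂ) :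
    IsSamplingFamily g z ↔ IsFrame fun j => atom g (z j) := by
  have hn : ∀ f, eLpNorm (gaborTransform g f) 2 volume = ‖f‖ₑ := fun f => by
    rw [eLpNorm_gaborTransform, ← ofReal_norm g, hnorm, ENNReal.ofReal_one, mul_one]
  constructor
  · rintro ⟨A, B, hA, hB, h⟩
    refine ⟨A, B, hA, hB, fun f => ?_⟩
    have := h (gaborTransform g f) ⟨memLp_gaborTransform g f, f, fun _ => rfl⟩
    rwa [hn] at this
  · rintro ⟨A, B, hA, hB, h⟩
    refine ⟨A, B, hA, hB, ?_⟩
    rintro F ⟨-, f, hF⟩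
    obtain rfl : F = gaborTransform g f := funext hF
    rw [hn]
    exact h f

/-- The points of a Gabor Bessel sequence have bounded multiplicity on small discs. -/
theorem exists_encard_preimage_ball_le {ι : Type*} {g : L2R} (hnorm : ‖g‖ = 1) {w : ι → ℂ} {B : ℝ}
    (hB : ∀ f : L2R, ∑' j, ‖inner ℂ (atom g (w j)) f‖ₑ ^ 2 ≤ ENNReal.ofReal B * ‖f‖ₑ ^ 2) :
    ∃ r : ℝ, 0 < r ∧ ∃ N : ℕ, 0 < N ∧ ∀ ζ : ℂ, (w ⁻¹' Metric.ball ζ r).encard ≤ N := by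
  have hcont := (continuous_gaborTransform g g).norm.tendsto 0
  rw [gaborTransform_self_zero, inner_self_eq_norm_sq_to_K, hnorm] at hcont
  norm_num at hcont
  obtain ⟨r, hr, hball⟩ := Metric.eventually_nhds_iff.1
    (hcont.eventually_const_lt (u := 1 / 2) (by norm_num))
  -- Testing the Bessel bound on the unit vector `g_ζ`, each index whose point is in the disc
  -- contributes at least `(1/2)²`, so there are at most `4B` such indices. The `+ 1` supplies the
  -- positivity needed to divide by `N` later.
  refine ⟨r, hr, ⌈4 * B⌉₊ + 1, by omega, fun ζ => ?_⟩
  set S := w ⁻¹' Metric.ball ζ r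
  have h1 : ∀ j ∈ S, (1 / 4 : ℝ≥0∞) ≤ ‖inner ℂ (atom g (w j)) (atom g ζ)‖ₑ ^ 2 := by
    intro j hj
    have h2 : ‖inner ℂ (atom g (w j)) (atom g ζ)‖ = ‖gaborTransform g g (w j - ζ)‖ := by
      rw [← neg_neg ζ, ← norm_inner_atom_comm, norm_inner_atom_atom_left, gaborTransform,
        sub_eq_add_neg, neg_neg]
    have h3 := hball (y := w j - ζ) (by simpa [S, dist_eq_norm] using hj)
    rw [← ofReal_norm, h2, ← ENNReal.ofReal_pow (norm_nonneg _)]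
    calc (1 / 4 : ℝ≥0∞) = ENNReal.ofReal (1 / 4) := by
          rw [ENNReal.ofReal_div_of_pos (by norm_num)]; simp
      _ ≤ _ := ENNReal.ofReal_le_ofReal (by nlinarith)
  have h4 : (S.encard : ℝ≥0∞) * (1 / 4) ≤ ENNReal.ofReal B := by
    calc (S.encard : ℝ≥0∞) * (1 / 4) = ∑' _ : S, (1 / 4 : ℝ≥0∞) := by
          rw [ENNReal.tsum_const]; rfl
      _ ≤ ∑' j : S, ‖inner ℂ (atom g (w j)) (atom g ζ)‖ₑ ^ 2 :=
          ENNReal.tsum_le_tsum fun j => h1 j j.2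
      _ ≤ ∑' j, ‖inner ℂ (atom g (w j)) (atom g ζ)‖ₑ ^ 2 :=
          ENNReal.tsum_comp_le_tsum_of_injective Subtype.val_injective _
      _ ≤ _ := hB _
      _ = _ := by rw [← ofReal_norm, norm_atom, hnorm]; simp
  have h5 : (S.encard : ℝ≥0∞) ≤ ENNReal.ofReal (4 * B) := by
    calc (S.encard : ℝ≥0∞) = 4 * ((S.encard : ℝ≥0∞) * (1 / 4)) := by
          rw [mul_comm, mul_assoc, one_div, ENNReal.inv_mul_cancel] <;> simp
      _ ≤ 4 * ENNReal.ofReal B := by gcongr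
      _ = _ := by rw [ENNReal.ofReal_mul (by norm_num), ENNReal.ofReal_ofNat]
  have h6 : (S.encard : ℝ≥0∞) ≤ ((⌈4 * B⌉₊ + 1 : ℕ) : ℝ≥0∞) := by
    refine h5.trans ?_
    rw [← ENNReal.ofReal_natCast]
    refine ENNReal.ofReal_le_ofReal ((Nat.le_ceil _).trans ?_)
    push_cast; linarith
  exact_mod_cast h6

theorem isDiscrete_range_of_encard_le {ι : Type*} {w : ι → ℂ} {r : ℝ} (hr : 0 < r) {N : ℕ}
    (h : ∀ ζ : ℂ, (w ⁻¹' Metric.ball ζ r).encard ≤ N) : IsDiscrete (range w) := by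
  refine isDiscrete_iff_forall_mem_exists_isOpen.2 fun l hl => ?_
  have hfin : (Metric.ball l r ∩ range w).Finite := by
    rw [← image_preimage_eq_inter_range]
    exact (finite_of_encard_le_coe (h l)).image w
  refine ⟨Metric.ball l r \ ((Metric.ball l r ∩ range w) \ {l}),
    Metric.isOpen_ball.sdiff (hfin.subset sdiff_subset).isClosed, ?_⟩
  ext x
  simp only [mem_inter_iff, mem_sdiff, mem_singleton_iff]
  constructor
  · tauto
  · rintro rfl
    simp [hr, hl]

/-- Group the indices by their point; each fibre has at most `N` elements. This carries the lower
sampling bound from the family to its range, at the cost of `A / N`. -/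
theorem tsum_comp_le_mul_tsum_range {ι : Type*} {w : ι → ℂ} {N : ℕ}
    (h : ∀ l : ℂ, (w ⁻¹' {l}).encard ≤ N) (F : ℂ → ℝ≥0∞) :
    ∑' j, F (w j) ≤ N * ∑' l : range w, F l := by
  rw [← (Equiv.sigmaFiberEquiv (rangeFactorization w)).tsum_eq, ENNReal.tsum_sigma',
    ← ENNReal.tsum_mul_left]
  refine ENNReal.tsum_le_tsum fun l => ?_
  have h1 : ∀ j : {j // rangeFactorization w j = l},
      F (w (Equiv.sigmaFiberEquiv (rangeFactorization w) ⟨l, j⟩)) = F l := fun j => by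
    obtain ⟨j, hj⟩ := j
    simp [Equiv.sigmaFiberEquiv, ← hj]
  simp_rw [h1]
  rw [ENNReal.tsum_const]
  gcongr
  have h2 : ENat.card {j // rangeFactorization w j = l} = (w ⁻¹' {(l : ℂ)}).encard := by
    rw [Set.encard]
    refine ENat.card_congr (Equiv.subtypeEquivRight fun j => ?_)
    simp [Subtype.ext_iff]
  rw [h2]
  exact_mod_cast h l

theorem tsum_range_le_tsum_comp {ι : Type*} (w : ι → ℂ) (F : ℂ → ℝ≥0∞) :
    ∑' l : range w, F l ≤ ∑' j, F (w j) := by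
  have h : ∀ l : range w, w (rangeSplitting w l) = l := apply_rangeSplitting w
  calc ∑' l : range w, F l = ∑' l : range w, (fun j => F (w j)) (rangeSplitting w l) := by
        simp_rw [h]
    _ ≤ _ := ENNReal.tsum_comp_le_tsum_of_injective (rangeSplitting_injective w) _

/-- The set of points of a sampling family is a sampling set. -/
theorem IsSamplingFamily.isSamplingSet_range {ι : Type*} {g : L2R} (hnorm : ‖g‖ = 1) {w : ι → ℂ}
    (hw : IsSamplingFamily g w) : IsSamplingSet g (range w) := by
  obtain ⟨_, B₀, _, _, hB₀⟩ := (isSamplingFamily_iff_isFrame hnorm w).1 hw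
  obtain ⟨r, hr, N, hN, hcard⟩ := exists_encard_preimage_ball_le hnorm fun f => (hB₀ f).2
  refine ⟨isDiscrete_range_of_encard_le hr hcard, ?_⟩
  obtain ⟨A, B, hA, hB, h⟩ := hw
  refine ⟨A / N, B, by positivity, hB, fun F hF => ⟨?_, ?_⟩⟩
  · have h1 := (h F hF).1.trans (tsum_comp_le_mul_tsum_range (N := N)
      (fun l => (encard_le_encard (preimage_mono (by simpa using hr))).trans (hcard l))
      fun x => ‖F x‖ₑ ^ 2)
    rw [ENNReal.ofReal_div_of_pos (by positivity), ENNReal.ofReal_natCast, mul_comm, ← mul_div_assoc,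
      mul_comm]
    exact ENNReal.div_le_of_le_mul' h1
  · exact (tsum_range_le_tsum_comp w fun x => ‖F x‖ₑ ^ 2).trans (h F hF).2

end GaborSampling

theorem mainTheorem3 (g : GaborSampling.L2R) (hnorm : ‖g‖ = 1)
    (hg : g ∈ GaborSampling.feichtingerAlgebra) :
    (∀ z : ℕ → ℂ, Function.Injective z → GaborSampling.IsSamplingSet g (Set.range z) →
      ∃ δ : ℝ, 0 < δ ∧ ∀ w : ℕ → ℂ, (∀ j, ‖z j - w j‖ < δ) →
        GaborSampling.IsSamplingSet g (Set.range w) ∧ GaborSampling.IsSamplingFamily g w) ∧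
    (∀ z : ℕ → ℂ, GaborSampling.IsFrame (fun j => GaborSampling.atom g (z j)) →
      ∃ δ : ℝ, 0 < δ ∧ ∀ w : ℕ → ℂ, (∀ j, ‖z j - w j‖ < δ) →
        GaborSampling.IsFrame (fun j => GaborSampling.atom g (w j))) := by
  have h0 : g ≠ 0 := by
    rintro rfl
    simp at hnorm
  refine ⟨fun z hz hs => ?_, fun z hz => GaborSampling.exists_isFrame_perturbation h0 hg hz⟩
  have hfam : GaborSampling.IsSamplingFamily g z := by
    obtain ⟨A, B, hA, hB, h⟩ := hs.2
    refine ⟨A, B, hA, hB, fun F hF => ?_⟩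
    have h1 : ∑' j, ‖F (z j)‖ₑ ^ 2 = ∑' l : Set.range z, ‖F l‖ₑ ^ 2 :=
      (Equiv.ofInjective z hz).tsum_eq fun l : Set.range z => ‖F l‖ₑ ^ 2
    rw [h1]
    exact h F hF
  obtain ⟨δ, hδ, h⟩ := GaborSampling.exists_isFrame_perturbation h0 hg
    ((GaborSampling.isSamplingFamily_iff_isFrame hnorm z).1 hfam)
  refine ⟨δ, hδ, fun w hw => ?_⟩
  have hfw := (GaborSampling.isSamplingFamily_iff_isFrame hnorm w).2 (h w hw)
  exact ⟨hfw.isSamplingSet_range hnorm, hfw⟩
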